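/- Let $k\ge 2$ be an integer and let $G$ be a connected, simple, linear Lie group, that is, a connected closed subgroup $G\le GL_n(\mathbb{R})$, for some $n$, whose Lie algebra $\mathfrak{g}=\{X\in M_n(\mathbb{R}) : \exp(tX)\in G \text{ for all } t\in\mathbb{R}\}$ is a simple (in particular non-abelian) real Lie algebra. For $(g_1,\dots,g_k)\in G^k$ let $\overline{\langle g_1,\dots,g_k\rangle}$ be the closure, in the usual (Euclidean) topology, of the subgroup generated by $g_1,\dots,g_k$. Put $$G^k_{\mathrm{prop}}=\{(g_i)\in G^k : \overline{\langle g_1,\dots,g_k\rangle}\neq G\},$$ $$G^k_{\mathrm{prop}>0}=\{(g_i)\in G^k_{\mathrm{prop}} : \overline{\langle g_1,\dots,g_k\rangle}\text{ is not discrete}\}.$$ Equip $G^k$ with the Zariski topology, whose closed sets are the sets of common zeros in $G^k$ of families of real polynomials in the $kn^2$ matrix entries of the tuple. Then the Zariski closure of $G^k_{\mathrm{prop}>0}$ in $G^k$ is contained in $G^k_{\mathrm{prop}}$. -/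

import Mathlib

open Filter Topology
open scoped Matrix MatrixGroups

attribute [local instance 100] LieRing.ofAssociativeRing

/-! ### The Lie algebra of a linear Lie group

A linear Lie group is a closed subgroup `G` of `GL (Fin n) ℝ`. Its Lie algebra is the real Lie
subalgebra `{X | exp (t X) ∈ G for all real t}` of the Lie algebra of all `n × n` matrices; that
this set is a Lie subalgebra is proved here. -/

section BanachAlgebra

open NormedSpace

variable {A : Type*} [NormedRing A] [NormedAlgebra ℝ A] [CompleteSpace A]

/-- If a curve `γ` has `γ 0 = 1` and velocity `Z` at `0`, then `γ (1 / m) ^ m` tends to `exp Z`. -/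
lemma tendsto_pow_exp_of_hasDerivAt [NormedAlgebra ℚ A] {γ : ℝ → A} {Z : A} (h0 : γ 0 = 1)
    (hd : HasDerivAt γ Z 0) :
    Tendsto (fun m : ℕ => γ ((m : ℝ)⁻¹) ^ m) atTop (𝓝 (exp Z)) := by
  have hs : HasStrictFDerivAt (exp : A → A)
      ((ContinuousLinearEquiv.refl ℝ A : A ≃L[ℝ] A) : A →L[ℝ] A) 0 :=
    hasStrictFDerivAt_exp_zero
  set L := hs.localInverse with hL
  have hLd := hs.to_localInverse.hasFDerivAt
  have hL0 : L (exp 0) = 0 := hs.localInverse_apply_image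
  have hright := hs.eventually_right_inverse
  rw [exp_zero] at hLd hL0 hright
  rw [← h0] at hLd
  have hc : HasDerivAt (fun s => L (γ s)) Z 0 := hLd.comp_hasDerivAt (0 : ℝ) hd
  have hinv : Tendsto (fun m : ℕ => ((m : ℝ)⁻¹)) atTop (𝓝 0) :=
    tendsto_inv_atTop_nhds_zero_nat
  have hinv' : Tendsto (fun m : ℕ => ((m : ℝ)⁻¹)) atTop (𝓝[≠] 0) := by
    refine tendsto_nhdsWithin_iff.2 ⟨hinv, ?_⟩
    filter_upwards [eventually_gt_atTop 0] with m hm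
    simp [hm.ne']
  have hsl := hc.tendsto_slope.comp hinv'
  have hlim : Tendsto (fun m : ℕ => exp (m • L (γ ((m : ℝ)⁻¹)))) atTop (𝓝 (exp Z)) := by
    refine (exp_continuous.tendsto Z).comp ?_
    refine hsl.congr fun m => ?_
    simp only [Function.comp, slope_def_module, sub_zero, h0, hL0, inv_inv]
    exact Nat.cast_smul_eq_nsmul ℝ m _
  refine hlim.congr' ?_
  have hev : ∀ᶠ m : ℕ in atTop, exp (L (γ ((m : ℝ)⁻¹))) = γ ((m : ℝ)⁻¹) := by
    have : Tendsto (fun m : ℕ => γ ((m : ℝ)⁻¹)) atTop (𝓝 1) := by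
      have := hd.continuousAt.tendsto.comp hinv
      rwa [h0] at this
    exact this.eventually hright
  filter_upwards [hev] with m hm
  rw [exp_nsmul, hm]

/-- The Lie product formula. -/
lemma tendsto_lie_product [NormedAlgebra ℚ A] (X Y : A) :
    Tendsto (fun m : ℕ => (exp ((m : ℝ)⁻¹ • X) * exp ((m : ℝ)⁻¹ • Y)) ^ m) atTop
      (𝓝 (exp (X + Y))) := by
  have hd : HasDerivAt (fun s : ℝ => exp (s • X) * exp (s • Y)) (X + Y) 0 := by
    have h1 := hasDerivAt_exp_smul_const (𝕂 := ℝ) X (0 : ℝ)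
    have h2 := hasDerivAt_exp_smul_const (𝕂 := ℝ) Y (0 : ℝ)
    simpa using h1.fun_mul h2
  exact tendsto_pow_exp_of_hasDerivAt (by simp) hd

/-- The commutator as a limit of difference quotients of a conjugation. -/
lemma tendsto_lie_bracket [NormedAlgebra ℚ A] (X Y : A) :
    Tendsto (fun s : ℝ => s⁻¹ • (exp (s • X) * Y * exp (s • (-X)) - Y)) (𝓝[≠] 0)
      (𝓝 ⁅X, Y⁆) := by
  have hd : HasDerivAt (fun s : ℝ => exp (s • X) * Y * exp (s • (-X))) ⁅X, Y⁆ 0 := by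
    have h1 := hasDerivAt_exp_smul_const (𝕂 := ℝ) X (0 : ℝ)
    have h2 := hasDerivAt_exp_smul_const (𝕂 := ℝ) (-X) (0 : ℝ)
    simpa [Ring.lie_def, sub_eq_add_neg] using (h1.mul_const Y).fun_mul h2
  refine hd.tendsto_slope.congr fun s => ?_
  simp [slope_def_module]

end BanachAlgebra

section MatrixLimits

open scoped Matrix.Norms.Operator
open NormedSpace

lemma Matrix.tendsto_lie_product {n : ℕ} (X Y : Matrix (Fin n) (Fin n) ℝ) :
    Tendsto (fun m : ℕ => (exp ((m : ℝ)⁻¹ • X) * exp ((m : ℝ)⁻¹ • Y)) ^ m) atTop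
      (𝓝 (exp (X + Y))) :=
  _root_.tendsto_lie_product X Y

lemma Matrix.tendsto_lie_bracket {n : ℕ} (X Y : Matrix (Fin n) (Fin n) ℝ) :
    Tendsto (fun s : ℝ => s⁻¹ • (exp (s • X) * Y * exp (s • (-X)) - Y)) (𝓝[≠] 0)
      (𝓝 ⁅X, Y⁆) :=
  _root_.tendsto_lie_bracket X Y

lemma Matrix.exp_mem_of_tendsto {n : ℕ} {G : Subgroup (GL (Fin n) ℝ)}
    (hG : IsClosed (G : Set (GL (Fin n) ℝ)))
    {X : Matrix (Fin n) (Fin n) ℝ} (u : ℕ → GL (Fin n) ℝ) (hu : ∀ m, u m ∈ G)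
    (h : Tendsto (fun m => (u m : Matrix (Fin n) (Fin n) ℝ)) atTop (𝓝 (exp X))) :
    ∃ g ∈ G, (g : Matrix (Fin n) (Fin n) ℝ) = exp X := by
  obtain ⟨g, hg⟩ := Matrix.isUnit_exp X
  refine ⟨g, ?_, hg⟩
  refine hG.mem_of_tendsto (b := atTop) (f := u) ?_ (Eventually.of_forall hu)
  rw [← hg] at h
  exact (Units.isOpenEmbedding_val (R := Matrix (Fin n) (Fin n) ℝ)).tendsto_nhds_iff.2 h

end MatrixLimits

section LieAlgebraOfLinearGroup

open NormedSpace

/-- The underlying vector space of the Lie algebra of a linear Lie group. -/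
def linearLieSubmodule {n : ℕ} (G : Subgroup (GL (Fin n) ℝ))
    (hG : IsClosed (G : Set (GL (Fin n) ℝ))) :
    Submodule ℝ (Matrix (Fin n) (Fin n) ℝ) where
  carrier := {X | ∀ t : ℝ, ∃ g ∈ G, (g : Matrix (Fin n) (Fin n) ℝ) = exp (t • X)}
  zero_mem' := fun t => ⟨1, one_mem G, by simp⟩
  add_mem' := by
    intro X Y hX hY t
    choose g hg hgX using hX
    choose h hh hhY using hY
    have hlim := Matrix.tendsto_lie_product (t • X) (t • Y)
    rw [← smul_add] at hlim
    refine Matrix.exp_mem_of_tendsto hG (fun m => (g ((m : ℝ)⁻¹ * t) * h ((m : ℝ)⁻¹ * t)) ^ m)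
      (fun m => pow_mem (mul_mem (hg _) (hh _)) m) (hlim.congr fun m => ?_)
    simp [hgX, hhY, smul_smul]
  smul_mem' := fun c X hX t => by simpa [smul_smul] using hX (t * c)

/-- The Lie algebra `{X | exp (t X) ∈ G for all real t}` of a linear Lie group `G`, as a real Lie
algebra of matrices with the commutator bracket. -/
def linearLieAlgebra {n : ℕ} (G : Subgroup (GL (Fin n) ℝ))
    (hG : IsClosed (G : Set (GL (Fin n) ℝ))) :
    LieSubalgebra ℝ (Matrix (Fin n) (Fin n) ℝ) where
  toSubmodule := linearLieSubmodule G hG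
  lie_mem' := by
    intro X Y hX hY
    change ⁅X, Y⁆ ∈ linearLieSubmodule G hG
    have hmem : ∀ s : ℝ, exp (s • X) * Y * exp (s • (-X)) ∈ linearLieSubmodule G hG := by
      intro s t
      obtain ⟨g, hg, e⟩ := hX s
      obtain ⟨h, hh, e2⟩ := hY t
      refine ⟨g * h * g⁻¹, mul_mem (mul_mem hg hh) (inv_mem hg), ?_⟩
      have e3 : ((g⁻¹ : GL (Fin n) ℝ) : Matrix (Fin n) (Fin n) ℝ) = exp (s • (-X)) := by
        rw [smul_neg, Matrix.exp_neg, ← e, Matrix.coe_units_inv]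
      have := Matrix.exp_units_conj g (t • Y)
      rw [Units.val_mul, Units.val_mul, e2, ← this, ← e, ← e3]
      congr 1
      simp
    have hcl : IsClosed (linearLieSubmodule G hG : Set (Matrix (Fin n) (Fin n) ℝ)) :=
      Submodule.closed_of_finiteDimensional _
    refine hcl.mem_of_tendsto (Matrix.tendsto_lie_bracket X Y) (Eventually.of_forall fun s => ?_)
    exact (linearLieSubmodule G hG).smul_mem _ ((linearLieSubmodule G hG).sub_mem (hmem s) hY)

end LieAlgebraOfLinearGroup

/-! ### Tuples of elements that do not generate -/

/-- The tuples in `G ^ k` for which the closure of the generated subgroup is proper. -/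
def properTuples (G : Type*) [Group G] [TopologicalSpace G] [IsTopologicalGroup G] (k : ℕ) :
    Set (Fin k → G) :=
  {g | (Subgroup.closure (Set.range g)).topologicalClosure ≠ ⊤}

/-- The tuples in `G ^ k` for which the closure of the generated subgroup is proper and not
discrete. -/
def properNondiscreteTuples (G : Type*) [Group G] [TopologicalSpace G] [IsTopologicalGroup G]
    (k : ℕ) : Set (Fin k → G) :=
  {g | g ∈ properTuples G k ∧
    ¬ DiscreteTopology (Subgroup.closure (Set.range g)).topologicalClosure}

/-! ### The Zariski topology on the powers of a linear group -/

/-- The value of a real polynomial in the `k * n * n` matrix entries at a tuple of `k` matrices. -/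
noncomputable def evalEntries {n k : ℕ} {G : Subgroup (GL (Fin n) ℝ)}
    (p : MvPolynomial (Fin k × Fin n × Fin n) ℝ) (g : Fin k → G) : ℝ :=
  MvPolynomial.eval
    (fun i => ((g i.1 : GL (Fin n) ℝ) : Matrix (Fin n) (Fin n) ℝ) i.2.1 i.2.2) p

/-- A subset of `G ^ k` is Zariski closed if it is the set of common zeros in `G ^ k` of a set of
real polynomials in the matrix entries; this is the restriction to `G ^ k` of the Zariski topology
of `GL (Fin n) ℝ ^ k`, an open subset of an affine space. -/
def IsZariskiClosed {n k : ℕ} {G : Subgroup (GL (Fin n) ℝ)} (C : Set (Fin k → G)) : Prop :=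
  ∃ P : Set (MvPolynomial (Fin k × Fin n × Fin n) ℝ),
    C = {g | ∀ p ∈ P, evalEntries p g = 0}

/-- The Zariski closure in `G ^ k`: the smallest Zariski closed set that contains `S`. -/
def zariskiClosure {n k : ℕ} {G : Subgroup (GL (Fin n) ℝ)} (S : Set (Fin k → G)) :
    Set (Fin k → G) :=
  ⋂₀ {C | IsZariskiClosed C ∧ S ⊆ C}

/-! Linear algebra in the span of the conjugations `X ↦ u * X * u⁻¹` separates generating tuples
from proper nondiscrete ones. If `g` generates a dense subgroup, the conjugations by words in `g`
span the same space as those by all of `G`, since a finite-dimensional subspace is closed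
(`conjCoeff_mem_span_of_not_mem_properTuples`). If `g'` generates a proper nondiscrete closed
subgroup `K`, the Lie algebra of `K` is nonzero, smaller than that of `G` (as `G` is connected), and
stable under the words in `g'`. Were every conjugation by `G` in the span of those words, it would
be a nontrivial ideal, against simplicity (`exists_conjCoeff_not_mem_span`).

Now fix a generating `g` and words `w j` whose conjugations at `g` form a basis of that span. At a
proper nondiscrete `g'` the same words must be dependent: otherwise, by dimension, they would span
all conjugations by `G`. A determinant detecting this is a regular function of the tuple, vanishes
on the proper nondiscrete tuples and equals `1` at `g`, so `g` lies outside their Zariski closure.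
-/

section ExponentialCoordinates

open NormedSpace

/-- If `V` and `W` are complementary subspaces, then the elements `exp x * exp w` with small
`x ∈ V` and `w ∈ W` form a neighbourhood of `1`. -/
lemma map_exp_mul_exp_nhds {A : Type*} [NormedRing A] [NormedAlgebra ℝ A] [NormedAlgebra ℚ A]
    [FiniteDimensional ℝ A] {V W : Submodule ℝ A} (h : IsCompl V W) :
    map (fun p : V × W => exp (p.1 : A) * exp (p.2 : A)) (𝓝 0) = 𝓝 1 := by
  have := FiniteDimensional.complete ℝ A
  let e : (V × W) ≃L[ℝ] A := (Submodule.prodEquivOfIsCompl V W h).toContinuousLinearEquiv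
  have hs : HasStrictFDerivAt (exp : A → A) (1 : A →L[ℝ] A) 0 := hasStrictFDerivAt_exp_zero
  have h1 : HasStrictFDerivAt (fun p : V × W => exp (p.1 : A))
      (V.subtypeL.comp (ContinuousLinearMap.fst ℝ V W)) 0 :=
    HasStrictFDerivAt.comp (0 : V × W) (g := exp) (g' := 1) (by simpa using hs)
      (V.subtypeL.comp (ContinuousLinearMap.fst ℝ V W)).hasStrictFDerivAt
  have h2 : HasStrictFDerivAt (fun p : V × W => exp (p.2 : A))
      (W.subtypeL.comp (ContinuousLinearMap.snd ℝ V W)) 0 :=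
    HasStrictFDerivAt.comp (0 : V × W) (g := exp) (g' := 1) (by simpa using hs)
      (W.subtypeL.comp (ContinuousLinearMap.snd ℝ V W)).hasStrictFDerivAt
  have h3 : HasStrictFDerivAt (fun p : V × W => exp (p.1 : A) * exp (p.2 : A))
      (e : (V × W) →L[ℝ] A) 0 := by
    refine (h1.mul' h2).congr_fderiv (ContinuousLinearMap.ext fun p => ?_)
    simp [e, add_comm]
  simpa using h3.map_nhds_eq_of_equiv

end ExponentialCoordinates

/-! ### Closed subgroups and their Lie algebras -/

section ClosedSubgroups

open scoped Matrix.Norms.Operator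
open NormedSpace

variable {n : ℕ}

/-- A limit of directions of logarithms of elements of a closed subgroup `G` that tend to `1` lies
in the Lie algebra of `G`. -/
lemma mem_linearLieSubmodule_of_tendsto {G : Subgroup (GL (Fin n) ℝ)}
    (hG : IsClosed (G : Set (GL (Fin n) ℝ))) {w : ℕ → Matrix (Fin n) (Fin n) ℝ}
    (hw : ∀ m, ∃ g ∈ G, (g : Matrix (Fin n) (Fin n) ℝ) = exp (w m))
    (hw0 : ∀ m, w m ≠ 0) (hlim : Tendsto w atTop (𝓝 0)) {Y : Matrix (Fin n) (Fin n) ℝ}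
    (hY : Tendsto (fun m => ‖w m‖⁻¹ • w m) atTop (𝓝 Y)) :
    Y ∈ linearLieSubmodule G hG := by
  intro t
  choose g hg hgw using hw
  refine Matrix.exp_mem_of_tendsto hG (fun m => g m ^ ⌊t / ‖w m‖⌋) (fun m => zpow_mem (hg m) _) ?_
  have hn : Tendsto (fun m => ‖w m‖) atTop (𝓝 0) := by simpa using hlim.norm
  -- The rounding error is at most `‖w m‖`, so the chosen powers of `exp (w m)` approach `exp (t •
  -- Y)`.
  have hfloor : Tendsto (fun m => (⌊t / ‖w m‖⌋ : ℝ) * ‖w m‖) atTop (𝓝 t) := by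
    have hb : Tendsto (fun m => (⌊t / ‖w m‖⌋ : ℝ) * ‖w m‖ - t) atTop (𝓝 0) := by
      refine squeeze_zero_norm (fun m => ?_) hn
      have hp : 0 < ‖w m‖ := norm_pos_iff.2 (hw0 m)
      have h1 := Int.floor_le (t / ‖w m‖)
      have h2 := Int.lt_floor_add_one (t / ‖w m‖)
      rw [le_div_iff₀ hp] at h1
      rw [div_lt_iff₀ hp] at h2
      rw [Real.norm_eq_abs, abs_le]
      constructor <;> linarith
    simpa using hb.add_const t
  have hexp := ((exp_continuous (𝔸 := Matrix (Fin n) (Fin n) ℝ)).tendsto (t • Y)).comp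
    (hfloor.smul hY)
  refine hexp.congr fun m => ?_
  have hp : ‖w m‖ ≠ 0 := norm_ne_zero_iff.2 (hw0 m)
  simp only [Function.comp]
  rw [smul_smul, mul_assoc, mul_inv_cancel₀ hp, mul_one, Matrix.coe_units_zpow, hgw,
    ← Matrix.exp_zsmul, Int.cast_smul_eq_zsmul]
  rfl

lemma Matrix.map_exp_mul_exp_nhds {V W : Submodule ℝ (Matrix (Fin n) (Fin n) ℝ)}
    (h : IsCompl V W) :
    Filter.map (fun p : V × W => exp (p.1 : Matrix (Fin n) (Fin n) ℝ) *
      exp (p.2 : Matrix (Fin n) (Fin n) ℝ)) (𝓝 (0 : V × W)) =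
      𝓝 (1 : Matrix (Fin n) (Fin n) ℝ) :=
  _root_.map_exp_mul_exp_nhds h

/-- A closed subgroup `H` of a closed linear group `G` with the same Lie algebra contains a
neighbourhood of `1` in `G`. -/
lemma eventually_mem_of_linearLieSubmodule_le {G H : Subgroup (GL (Fin n) ℝ)}
    (hG : IsClosed (G : Set (GL (Fin n) ℝ))) (hH : IsClosed (H : Set (GL (Fin n) ℝ)))
    (hHG : H ≤ G) (h : linearLieSubmodule G hG ≤ linearLieSubmodule H hH) :
    ∀ᶠ g in 𝓝 (1 : GL (Fin n) ℝ), g ∈ G → g ∈ H := by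
  by_contra hne
  obtain ⟨W, hW⟩ := (linearLieSubmodule H hH).exists_isCompl
  -- Write an element of `G` near `1` as `exp x * exp w` with `x` in the Lie algebra of `H`. Then
  -- `exp w` is in `G`, and `w = 0` would put the element in `H`. Limit directions of such `w` lie
  -- both in `W` and in the Lie algebra of `G`, which is impossible for a unit vector.
  have key : ∀ ε > 0, ∃ w ∈ W, w ≠ 0 ∧ ‖w‖ < ε ∧
      ∃ g ∈ G, (g : Matrix (Fin n) (Fin n) ℝ) = exp w := by
    intro ε hε
    by_contra hno
    refine hne ?_
    have hmem : (fun p : linearLieSubmodule H hH × W => exp (p.1 : Matrix (Fin n) (Fin n) ℝ) *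
      exp (p.2 : Matrix (Fin n) (Fin n) ℝ)) '' Metric.ball 0 ε ∈
        𝓝 (1 : Matrix (Fin n) (Fin n) ℝ) := by
      rw [← Matrix.map_exp_mul_exp_nhds hW]
      exact image_mem_map (Metric.ball_mem_nhds _ hε)
    have hval : Tendsto (fun g : GL (Fin n) ℝ => (g : Matrix (Fin n) (Fin n) ℝ)) (𝓝 1) (𝓝 1) :=
      Units.continuous_val.tendsto' _ _ (by simp)
    filter_upwards [hval hmem] with g hg hgG
    obtain ⟨⟨x, w⟩, hxw, hgxw⟩ := hg
    simp only at hgxw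
    obtain ⟨u, hu, hux⟩ := x.2 1
    rw [one_smul] at hux
    have hw : ((u⁻¹ * g : GL (Fin n) ℝ) : Matrix (Fin n) (Fin n) ℝ) =
        exp (w : Matrix (Fin n) (Fin n) ℝ) := by
      rw [Units.val_mul, ← hgxw, ← hux, Units.inv_mul_cancel_left]
    by_cases hw0 : (w : Matrix (Fin n) (Fin n) ℝ) = 0
    · have : u⁻¹ * g = 1 := Units.ext (by rw [hw, hw0, exp_zero, Units.val_one])
      rw [inv_mul_eq_one] at this
      exact this ▸ hu
    · refine absurd ⟨w, w.2, hw0, ?_, u⁻¹ * g, mul_mem (inv_mem (hHG hu)) hgG, hw⟩ hno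
      rw [mem_ball_zero_iff] at hxw
      exact (norm_snd_le (x, w)).trans_lt hxw
  choose w hwW hw0 hwε hwG using fun m : ℕ => key (1 / ((m : ℝ) + 1)) (by positivity)
  have hw : Tendsto w atTop (𝓝 0) :=
    squeeze_zero_norm (fun m => (hwε m).le) tendsto_one_div_add_atTop_nhds_zero_nat
  have hs : ∀ m, ‖w m‖⁻¹ • w m ∈ Metric.sphere (0 : Matrix (Fin n) (Fin n) ℝ) 1 := fun m => by
    rw [mem_sphere_zero_iff_norm, norm_smul, norm_inv, norm_norm,
      inv_mul_cancel₀ (norm_ne_zero_iff.2 (hw0 m))]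
  obtain ⟨Y, hYs, φ, hφ, hYlim⟩ := (isCompact_sphere _ _).tendsto_subseq hs
  have hYG : Y ∈ linearLieSubmodule G hG :=
    mem_linearLieSubmodule_of_tendsto hG (fun m => hwG (φ m)) (fun m => hw0 _)
      (hw.comp hφ.tendsto_atTop) hYlim
  have hYW : Y ∈ W :=
    (Submodule.closed_of_finiteDimensional W).mem_of_tendsto hYlim
      (Eventually.of_forall fun m => W.smul_mem _ (hwW _))
  have hY0 : Y = 0 := by
    have := hW.disjoint.le_bot (show Y ∈ _ ⊓ W from ⟨h hYG, hYW⟩)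
    simpa using this
  simp [hY0] at hYs

/-- A closed linear group with trivial Lie algebra is discrete. -/
lemma discreteTopology_of_linearLieSubmodule_eq_bot {G : Subgroup (GL (Fin n) ℝ)}
    (hG : IsClosed (G : Set (GL (Fin n) ℝ))) (h : linearLieSubmodule G hG = ⊥) :
    DiscreteTopology G := by
  have hev := eventually_mem_of_linearLieSubmodule_le hG (H := ⊥)
    (by simp) bot_le (h ▸ bot_le)
  refine discreteTopology_of_isOpen_singleton_one ?_
  rw [isOpen_singleton_iff_nhds_eq_pure]
  refine le_antisymm ?_ (pure_le_nhds _)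
  rw [le_pure_iff, nhds_subtype_eq_comap]
  filter_upwards [preimage_mem_comap hev] with g hg
  exact Subtype.ext (by simpa using hg g.2)

/-- A closed subgroup of a connected closed linear group with the same Lie algebra is the whole
group. -/
lemma eq_of_linearLieSubmodule_le {G H : Subgroup (GL (Fin n) ℝ)}
    (hG : IsClosed (G : Set (GL (Fin n) ℝ))) (hH : IsClosed (H : Set (GL (Fin n) ℝ)))
    (hconn : ConnectedSpace G) (hHG : H ≤ G)
    (h : linearLieSubmodule G hG ≤ linearLieSubmodule H hH) : H = G := by
  have hev := eventually_mem_of_linearLieSubmodule_le hG hH hHG h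
  have hopen : IsOpen (H.subgroupOf G : Set G) := by
    refine Subgroup.isOpen_of_mem_nhds _ (g := 1) ?_
    rw [nhds_subtype_eq_comap]
    filter_upwards [preimage_mem_comap hev] with g hg
    exact hg g.2
  have htop : (H.subgroupOf G : Set G) = Set.univ :=
    IsClopen.eq_univ ⟨Subgroup.isClosed_of_isOpen _ hopen, hopen⟩ ⟨1, one_mem _⟩
  refine le_antisymm hHG fun g hg => ?_
  have : (⟨g, hg⟩ : G) ∈ (H.subgroupOf G : Set G) := htop ▸ Set.mem_univ _
  exact this

end ClosedSubgroups

/-! ### Conjugation-invariant subspaces -/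

section InvariantSubspaces

open NormedSpace

variable {n : ℕ}

/-- A closed linear group acts on its Lie algebra by conjugation. -/
lemma conj_mem_linearLieSubmodule {G : Subgroup (GL (Fin n) ℝ)}
    (hG : IsClosed (G : Set (GL (Fin n) ℝ))) {u : GL (Fin n) ℝ} (hu : u ∈ G)
    {X : Matrix (Fin n) (Fin n) ℝ} (hX : X ∈ linearLieSubmodule G hG) :
    (u : Matrix (Fin n) (Fin n) ℝ) * X * ((u⁻¹ : GL (Fin n) ℝ) : Matrix (Fin n) (Fin n) ℝ) ∈
      linearLieSubmodule G hG := by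
  intro t
  obtain ⟨g, hg, e⟩ := hX t
  refine ⟨u * g * u⁻¹, mul_mem (mul_mem hu hg) (inv_mem hu), ?_⟩
  rw [Units.val_mul, Units.val_mul, e, ← Matrix.exp_units_conj]
  congr 1
  simp

lemma linearLieSubmodule_mono {G H : Subgroup (GL (Fin n) ℝ)}
    (hG : IsClosed (G : Set (GL (Fin n) ℝ))) (hH : IsClosed (H : Set (GL (Fin n) ℝ)))
    (h : H ≤ G) : linearLieSubmodule H hH ≤ linearLieSubmodule G hG := fun _ hX t =>
  (hX t).imp fun _ hg => ⟨h hg.1, hg.2⟩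

/-- If the Lie algebra of `G` is simple, then it has no conjugation-invariant subspaces other than
the trivial ones. -/
lemma eq_bot_or_eq_of_conj_mem {G : Subgroup (GL (Fin n) ℝ)}
    (hG : IsClosed (G : Set (GL (Fin n) ℝ)))
    (hsimple : LieAlgebra.IsSimple ℝ (linearLieAlgebra G hG))
    {V : Submodule ℝ (Matrix (Fin n) (Fin n) ℝ)} (hV : V ≤ linearLieSubmodule G hG)
    (hconj : ∀ u ∈ G, ∀ X ∈ V, (u : Matrix (Fin n) (Fin n) ℝ) * X *
      ((u⁻¹ : GL (Fin n) ℝ) : Matrix (Fin n) (Fin n) ℝ) ∈ V) :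
    V = ⊥ ∨ V = linearLieSubmodule G hG := by
  -- Differentiating the conjugation by `exp (s • X)` at `s = 0` stays in the closed subspace `V`,
  -- so `V` is an ideal.
  have hlie : ∀ X ∈ linearLieSubmodule G hG, ∀ Y ∈ V, ⁅X, Y⁆ ∈ V := by
    intro X hX Y hY
    refine (Submodule.closed_of_finiteDimensional V).mem_of_tendsto
      (Matrix.tendsto_lie_bracket X Y) (Eventually.of_forall fun s => ?_)
    obtain ⟨g, hg, e⟩ := hX s
    have e' : ((g⁻¹ : GL (Fin n) ℝ) : Matrix (Fin n) (Fin n) ℝ) = exp (s • (-X)) := by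
      rw [smul_neg, Matrix.exp_neg, ← e, Matrix.coe_units_inv]
    rw [← e, ← e']
    exact V.smul_mem _ (V.sub_mem (hconj g hg Y hY) hY)
  let I : LieIdeal ℝ (linearLieAlgebra G hG) :=
    { V.comap (linearLieAlgebra G hG).toSubmodule.subtype with
      lie_mem := fun {X Y} hY => hlie X X.2 Y hY }
  have hI : ∀ Z : linearLieAlgebra G hG, Z ∈ I ↔ (Z : Matrix (Fin n) (Fin n) ℝ) ∈ V :=
    fun _ => Iff.rfl
  rcases hsimple.eq_bot_or_eq_top I with h | h
  · refine Or.inl ((Submodule.eq_bot_iff _).2 fun X hX => ?_)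
    have : (⟨X, hV hX⟩ : linearLieAlgebra G hG) ∈ I := (hI _).2 hX
    rw [h, LieSubmodule.mem_bot] at this
    exact congrArg Subtype.val this
  · refine Or.inr (le_antisymm hV fun X hX => ?_)
    exact (hI ⟨X, hX⟩).1 (h ▸ LieSubmodule.mem_top _)

/-- The matrix coefficients of the conjugation by `x` on the space of all matrices. -/
def conjCoeff (x : GL (Fin n) ℝ) : Fin n × Fin n × Fin n × Fin n → ℝ := fun s =>
  (x : Matrix (Fin n) (Fin n) ℝ) s.1 s.2.1 *
    ((x⁻¹ : GL (Fin n) ℝ) : Matrix (Fin n) (Fin n) ℝ) s.2.2.1 s.2.2.2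

lemma continuous_conjCoeff : Continuous (conjCoeff (n := n)) := by
  refine continuous_pi fun s => ?_
  exact (Units.continuous_val.matrix_elem _ _).mul
    ((Units.continuous_val.comp continuous_inv).matrix_elem _ _)

/-- The image of a matrix under the endomorphism with given coefficients. -/
def applyCoeff (X : Matrix (Fin n) (Fin n) ℝ) :
    (Fin n × Fin n × Fin n × Fin n → ℝ) →ₗ[ℝ] Matrix (Fin n) (Fin n) ℝ where
  toFun v := Matrix.of fun i j => ∑ b, ∑ a, v (i, a, b, j) * X a b
  map_add' v w := by
    ext i j
    simp [add_mul, Finset.sum_add_distrib]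
  map_smul' r v := by
    ext i j
    simp [mul_assoc, Finset.mul_sum]

/-- For fixed `X` the conjugate depends linearly on the coefficient vector, which lets invariance
pass to linear spans. -/
lemma applyCoeff_conjCoeff (X : Matrix (Fin n) (Fin n) ℝ) (x : GL (Fin n) ℝ) :
    applyCoeff X (conjCoeff x) = (x : Matrix (Fin n) (Fin n) ℝ) * X *
      ((x⁻¹ : GL (Fin n) ℝ) : Matrix (Fin n) (Fin n) ℝ) := by
  ext i j
  simp only [applyCoeff, conjCoeff, LinearMap.coe_mk, AddHom.coe_mk, Matrix.of_apply,
    Matrix.mul_apply, Finset.sum_mul]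
  exact Finset.sum_congr rfl fun b _ => Finset.sum_congr rfl fun a _ => by ring

/-- A subspace that is invariant under the conjugations by a set of matrices is invariant under all
conjugations in the linear span of these. -/
lemma conj_mem_of_conjCoeff_mem_span {S : Set (GL (Fin n) ℝ)}
    {V : Submodule ℝ (Matrix (Fin n) (Fin n) ℝ)}
    (hV : ∀ u ∈ S, ∀ X ∈ V, (u : Matrix (Fin n) (Fin n) ℝ) * X *
      ((u⁻¹ : GL (Fin n) ℝ) : Matrix (Fin n) (Fin n) ℝ) ∈ V)
    {x : GL (Fin n) ℝ} (hx : conjCoeff x ∈ Submodule.span ℝ (conjCoeff '' S))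
    {X : Matrix (Fin n) (Fin n) ℝ} (hX : X ∈ V) :
    (x : Matrix (Fin n) (Fin n) ℝ) * X *
      ((x⁻¹ : GL (Fin n) ℝ) : Matrix (Fin n) (Fin n) ℝ) ∈ V := by
  rw [← applyCoeff_conjCoeff]
  have hle : Submodule.span ℝ (conjCoeff '' S) ≤ V.comap (applyCoeff X) := by
    rw [Submodule.span_le]
    rintro _ ⟨u, hu, rfl⟩
    rw [SetLike.mem_coe, Submodule.mem_comap, applyCoeff_conjCoeff]
    exact hV u hu X hX
  exact hle hx

end InvariantSubspaces

/-! ### Spans of conjugations by words -/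

section GeneratingTuples

variable {n k : ℕ} {G : Subgroup (GL (Fin n) ℝ)}

/-- For a topologically generating tuple, the conjugations by words span the conjugations by all
elements of the group. -/
lemma conjCoeff_mem_span_of_not_mem_properTuples {g : Fin k → G} (hg : g ∉ properTuples G k)
    (x : G) : conjCoeff (x : GL (Fin n) ℝ) ∈ Submodule.span ℝ
      (Set.range fun w : FreeGroup (Fin k) => conjCoeff (FreeGroup.lift g w : GL (Fin n) ℝ)) := by
  set A := Submodule.span ℝ
    (Set.range fun w : FreeGroup (Fin k) => conjCoeff (FreeGroup.lift g w : GL (Fin n) ℝ)) with hA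
  have hcl : IsClosed {y : G | conjCoeff (y : GL (Fin n) ℝ) ∈ A} :=
    (Submodule.closed_of_finiteDimensional A).preimage
      (continuous_conjCoeff.comp continuous_subtype_val)
  have hsub : ((Subgroup.closure (Set.range g) : Subgroup G) : Set G) ⊆
      {y : G | conjCoeff (y : GL (Fin n) ℝ) ∈ A} := by
    rw [← FreeGroup.range_lift_eq_closure]
    rintro _ ⟨w, rfl⟩
    exact Submodule.subset_span ⟨w, rfl⟩
  have htop : (Subgroup.closure (Set.range g)).topologicalClosure = ⊤ := by
    simpa [properTuples] using hg
  have hx : x ∈ (Subgroup.closure (Set.range g)).topologicalClosure := htop ▸ Subgroup.mem_top x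
  exact closure_minimal hsub hcl hx

/-- For a tuple that generates a proper nondiscrete closed subgroup of a group with simple Lie
algebra, the conjugations by words do not span the conjugations by all elements of the group. -/
lemma exists_conjCoeff_not_mem_span (hclosed : IsClosed (G : Set (GL (Fin n) ℝ)))
    (hconn : ConnectedSpace G) (hsimple : LieAlgebra.IsSimple ℝ (linearLieAlgebra G hclosed))
    {g : Fin k → G} (hg : g ∈ properNondiscreteTuples G k) :
    ∃ x : G, conjCoeff (x : GL (Fin n) ℝ) ∉ Submodule.span ℝ
      (Set.range fun w : FreeGroup (Fin k) => conjCoeff (FreeGroup.lift g w : GL (Fin n) ℝ)) := by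
  by_contra! hall
  obtain ⟨hproper, hnd⟩ := hg
  set K := (Subgroup.closure (Set.range g)).topologicalClosure with hK
  -- `K` is a subgroup of `G`; its image in `GL (Fin n) ℝ` is closed because `G` is, so it has a Lie
  -- algebra.
  have hH : IsClosed (K.map G.subtype : Set (GL (Fin n) ℝ)) :=
    hclosed.isClosedEmbedding_subtypeVal.isClosedMap (K : Set G)
      (Subgroup.closure (Set.range g)).isClosed_topologicalClosure
  have hHG : K.map G.subtype ≤ G := by
    rintro _ ⟨y, -, rfl⟩
    exact y.2
  have hinv : ∀ u ∈ G, ∀ X ∈ linearLieSubmodule _ hH, (u : Matrix (Fin n) (Fin n) ℝ) * X *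
      ((u⁻¹ : GL (Fin n) ℝ) : Matrix (Fin n) (Fin n) ℝ) ∈ linearLieSubmodule _ hH := by
    intro u hu X hX
    refine conj_mem_of_conjCoeff_mem_span
      (S := Set.range fun w : FreeGroup (Fin k) => (FreeGroup.lift g w : GL (Fin n) ℝ)) ?_ ?_ hX
    · rintro _ ⟨w, rfl⟩ Y hY
      refine conj_mem_linearLieSubmodule hH ⟨FreeGroup.lift g w, ?_, rfl⟩ hY
      refine Subgroup.le_topologicalClosure _ ?_
      rw [← FreeGroup.range_lift_eq_closure]
      exact ⟨w, rfl⟩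
    · rw [← Set.range_comp]
      exact hall ⟨u, hu⟩
  rcases eq_bot_or_eq_of_conj_mem hclosed hsimple (linearLieSubmodule_mono hclosed hH hHG) hinv
    with h | h
  · have hdisc := discreteTopology_of_linearLieSubmodule_eq_bot hH h
    refine hnd (DiscreteTopology.of_continuous_injective
      (f := fun y : K => (⟨y, y, y.2, rfl⟩ : K.map G.subtype)) ?_ ?_)
    · exact (continuous_subtype_val.comp continuous_subtype_val).subtype_mk _
    · intro y z hyz
      have h' : ((y : G) : GL (Fin n) ℝ) = (z : G) :=
        congrArg (fun u : K.map G.subtype => (u : GL (Fin n) ℝ)) hyz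
      exact Subtype.ext (Subtype.ext h')
  · have heq := eq_of_linearLieSubmodule_le hclosed hH hconn hHG h.ge
    refine hproper ((Subgroup.eq_top_iff' _).2 fun x => ?_)
    obtain ⟨y, hy, hyx⟩ : (x : GL (Fin n) ℝ) ∈ K.map G.subtype := heq.ge x.2
    rwa [← Subtype.ext hyx]

end GeneratingTuples

/-! ### Regular functions and Zariski closed sets -/

section RegularFunctions

variable {n k : ℕ} {G : Subgroup (GL (Fin n) ℝ)}

/-- The functions on `G ^ k` that are quotients of polynomials in the matrix entries, with a
denominator that vanishes nowhere on `G ^ k`. -/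
def regularFunctions (G : Subgroup (GL (Fin n) ℝ)) (k : ℕ) :
    Subalgebra ℝ ((Fin k → G) → ℝ) where
  carrier := {f | ∃ p q : MvPolynomial (Fin k × Fin n × Fin n) ℝ,
    (∀ g : Fin k → G, evalEntries q g ≠ 0) ∧
      ∀ g : Fin k → G, f g * evalEntries q g = evalEntries p g}
  mul_mem' := by
    rintro f₁ f₂ ⟨p₁, q₁, h₁, e₁⟩ ⟨p₂, q₂, h₂, e₂⟩
    refine ⟨p₁ * p₂, q₁ * q₂, fun g => ?_, fun g => ?_⟩
    · simpa [evalEntries] using ⟨h₁ g, h₂ g⟩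
    · have e₁ := e₁ g
      have e₂ := e₂ g
      simp only [evalEntries, map_mul, Pi.mul_apply] at *
      rw [← e₁, ← e₂]
      ring
  add_mem' := by
    rintro f₁ f₂ ⟨p₁, q₁, h₁, e₁⟩ ⟨p₂, q₂, h₂, e₂⟩
    refine ⟨p₁ * q₂ + p₂ * q₁, q₁ * q₂, fun g => ?_, fun g => ?_⟩
    · simpa [evalEntries] using ⟨h₁ g, h₂ g⟩
    · have e₁ := e₁ g
      have e₂ := e₂ g
      simp only [evalEntries, map_mul, map_add, Pi.add_apply] at *
      rw [← e₁, ← e₂]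
      ring
  algebraMap_mem' r := ⟨MvPolynomial.C r, 1, fun g => by simp [evalEntries],
    fun g => by simp [evalEntries]⟩

lemma regularFunctions_mul_apply {A B : (Fin k → G) → Matrix (Fin n) (Fin n) ℝ}
    (hA : ∀ i j, (fun g => A g i j) ∈ regularFunctions G k)
    (hB : ∀ i j, (fun g => B g i j) ∈ regularFunctions G k) (i j : Fin n) :
    (fun g => (A g * B g) i j) ∈ regularFunctions G k := by
  have : (fun g => (A g * B g) i j) = ∑ l, (fun g => A g i l) * fun g => B g l j := by
    ext g
    simp [Matrix.mul_apply]
  rw [this]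
  exact sum_mem fun l _ => mul_mem (hA i l) (hB l j)

lemma evalEntries_det (a : Fin k) (g : Fin k → G) :
    evalEntries (Matrix.det (Matrix.of fun i j => MvPolynomial.X (a, i, j))) g =
      ((g a : GL (Fin n) ℝ) : Matrix (Fin n) (Fin n) ℝ).det := by
  rw [evalEntries, RingHom.map_det]
  congr 1
  ext i j
  simp

lemma evalEntries_adjugate (a : Fin k) (g : Fin k → G) (i j : Fin n) :
    evalEntries (Matrix.adjugate (Matrix.of fun i j => MvPolynomial.X (a, i, j)) i j) g =
      ((g a : GL (Fin n) ℝ) : Matrix (Fin n) (Fin n) ℝ).adjugate i j := by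
  have h := RingHom.map_adjugate (MvPolynomial.eval
    (fun i => ((g i.1 : GL (Fin n) ℝ) : Matrix (Fin n) (Fin n) ℝ) i.2.1 i.2.2))
    (Matrix.of fun i j => MvPolynomial.X (a, i, j))
  have h' := congrFun (congrFun h i) j
  rw [RingHom.mapMatrix_apply, Matrix.map_apply] at h'
  rw [evalEntries, h']
  congr 2
  ext i j
  simp

/-- The matrix entries of a word are regular functions. -/
lemma lift_apply_mem_regularFunctions (w : FreeGroup (Fin k)) (i j : Fin n) :
    (fun g : Fin k → G => ((FreeGroup.lift g w : GL (Fin n) ℝ) : Matrix (Fin n) (Fin n) ℝ) i j) ∈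
      regularFunctions G k := by
  induction w using FreeGroup.induction_on generalizing i j with
  | C1 =>
    refine ⟨MvPolynomial.C ((1 : Matrix (Fin n) (Fin n) ℝ) i j), 1, fun g => ?_, fun g => ?_⟩ <;>
      simp [evalEntries]
  | of a => exact ⟨MvPolynomial.X (a, i, j), 1, fun g => by simp [evalEntries],
      fun g => by simp [evalEntries]⟩
  | inv_of a _ =>
    -- Inverse letters are the reason for allowing denominators: the inverse is the adjugate over
    -- the determinant.
    refine ⟨Matrix.adjugate (Matrix.of fun i j => MvPolynomial.X (a, i, j)) i j,
      Matrix.det (Matrix.of fun i j => MvPolynomial.X (a, i, j)), fun g => ?_, fun g => ?_⟩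
    · rw [evalEntries_det]
      exact ((Matrix.isUnit_iff_isUnit_det _).1 (g a : GL (Fin n) ℝ).isUnit).ne_zero
    · have hd : ((g a : GL (Fin n) ℝ) : Matrix (Fin n) (Fin n) ℝ).det ≠ 0 :=
        ((Matrix.isUnit_iff_isUnit_det _).1 (g a : GL (Fin n) ℝ).isUnit).ne_zero
      simp only [evalEntries_det, evalEntries_adjugate, map_inv, FreeGroup.lift_apply_of,
        Subgroup.coe_inv, Matrix.coe_units_inv, Matrix.inv_def, Matrix.smul_apply,
        Ring.inverse_eq_inv', smul_eq_mul]
      field_simp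
  | mul x y hx hy =>
    simp only [map_mul, Subgroup.coe_mul, Units.val_mul]
    exact regularFunctions_mul_apply hx hy i j

/-- Linear functionals of the conjugation by a word are regular functions. -/
lemma conjCoeff_mem_regularFunctions (w : FreeGroup (Fin k))
    (φ : (Fin n × Fin n × Fin n × Fin n → ℝ) →ₗ[ℝ] ℝ) :
    (fun g : Fin k → G => φ (conjCoeff (FreeGroup.lift g w : GL (Fin n) ℝ))) ∈
      regularFunctions G k := by
  have : (fun g : Fin k → G => φ (conjCoeff (FreeGroup.lift g w : GL (Fin n) ℝ))) =
      ∑ s : Fin n × Fin n × Fin n × Fin n, (φ fun t => if s = t then 1 else 0) •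
        ((fun g : Fin k → G =>
          ((FreeGroup.lift g w : GL (Fin n) ℝ) : Matrix (Fin n) (Fin n) ℝ) s.1 s.2.1) *
        fun g : Fin k → G =>
          -- The inverse matrix in `conjCoeff` is the value of the word `w⁻¹`, so its entries are
          -- regular too.
          ((FreeGroup.lift g w⁻¹ : GL (Fin n) ℝ) : Matrix (Fin n) (Fin n) ℝ) s.2.2.1 s.2.2.2) := by
    ext g
    rw [LinearMap.pi_apply_eq_sum_univ, Finset.sum_apply]
    refine Finset.sum_congr rfl fun s _ => ?_
    simp only [conjCoeff, Pi.smul_apply, Pi.mul_apply, smul_eq_mul, map_inv, Subgroup.coe_inv]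
    ring
  rw [this]
  exact sum_mem fun s _ => Subalgebra.smul_mem _
    (mul_mem (lift_apply_mem_regularFunctions _ _ _) (lift_apply_mem_regularFunctions _ _ _)) _

lemma det_mem_regularFunctions {m : ℕ} {N : (Fin k → G) → Matrix (Fin m) (Fin m) ℝ}
    (hN : ∀ i j, (fun g => N g i j) ∈ regularFunctions G k) :
    (fun g => (N g).det) ∈ regularFunctions G k := by
  have : (fun g => (N g).det) =
      ∑ σ : Equiv.Perm (Fin m), ((Equiv.Perm.sign σ : ℤ) : ℝ) • ∏ i, fun g => N g (σ i) i := by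
    ext g
    simp [Matrix.det_apply', Finset.sum_apply]
  rw [this]
  exact sum_mem fun σ _ => Subalgebra.smul_mem _ (prod_mem fun i _ => hN _ _) _

/-- The zero set of a regular function is Zariski closed. -/
lemma isZariskiClosed_of_mem_regularFunctions {f : (Fin k → G) → ℝ}
    (hf : f ∈ regularFunctions G k) : IsZariskiClosed {g | f g = 0} := by
  obtain ⟨p, q, hq, e⟩ := hf
  refine ⟨{p}, Set.ext fun g => ?_⟩
  -- The numerator `p` alone cuts out the zero set, as `q` never vanishes.
  simp [← e, hq]

end RegularFunctions

theorem mainTheorem7 {n k : ℕ} (hk : 2 ≤ k) (G : Subgroup (GL (Fin n) ℝ))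
    (hclosed : IsClosed (G : Set (GL (Fin n) ℝ))) (hconn : ConnectedSpace G)
    (hsimple : LieAlgebra.IsSimple ℝ (linearLieAlgebra G hclosed)) :
    zariskiClosure (properNondiscreteTuples G k) ⊆ properTuples G k := by
  intro g hgZ
  by_contra hg
  let c : (Fin k → G) → FreeGroup (Fin k) → (Fin n × Fin n × Fin n × Fin n → ℝ) :=
    fun g' w => conjCoeff (FreeGroup.lift g' w : GL (Fin n) ℝ)
  obtain ⟨v, hv, hvspan, hvind⟩ := Submodule.exists_fun_fin_finrank_span_eq ℝ (Set.range (c g))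
  choose w hw using hv
  have hwind : LinearIndependent ℝ fun j => c g (w j) := by simpa only [hw] using hvind
  -- `φ` reads off coordinates in the basis given by the words at `g`. It stays fixed as the tuple
  -- varies, so `N g'` has regular entries and `N g = 1`.
  obtain ⟨φ, hφ⟩ := LinearMap.exists_leftInverse_of_injective
    (Fintype.linearCombination ℝ fun j => c g (w j))
    (LinearMap.ker_eq_bot.2 hwind.fintypeLinearCombination_injective)
  let N : (Fin k → G) → Matrix _ _ ℝ := fun g' => Matrix.of fun i j => φ (c g' (w j)) i
  have hreg : (fun g' => (N g').det) ∈ regularFunctions G k :=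
    det_mem_regularFunctions fun i j =>
      conjCoeff_mem_regularFunctions (w j) ((LinearMap.proj i).comp φ)
  have hvanish : properNondiscreteTuples G k ⊆ {g' | (N g').det = 0} := by
    intro g' hg'
    obtain ⟨x, hx⟩ := exists_conjCoeff_not_mem_span hclosed hconn hsimple hg'
    have hdep : ¬ LinearIndependent ℝ fun j => c g' (w j) := by
      intro hind
      have hle : Submodule.span ℝ (Set.range fun j => c g' (w j)) ≤
          Submodule.span ℝ (Set.range (c g)) := by
        rw [Submodule.span_le]
        rintro _ ⟨j, rfl⟩
        exact conjCoeff_mem_span_of_not_mem_properTuples hg _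
      -- The number of words is the dimension of the span at `g`, so independence at `g'` forces
      -- equality.
      have heq := Submodule.eq_of_le_of_finrank_eq hle
        (by rw [finrank_span_eq_card hind, Fintype.card_fin])
      refine hx ?_
      have hxg := conjCoeff_mem_span_of_not_mem_properTuples hg x
      change _ ∈ Submodule.span ℝ (Set.range (c g)) at hxg
      rw [← heq] at hxg
      refine Submodule.span_mono ?_ hxg
      rintro _ ⟨j, rfl⟩
      exact ⟨w j, rfl⟩
    obtain ⟨a, ha, j, hj⟩ := Fintype.not_linearIndependent_iff.1 hdep
    -- Applying `φ` to the linear relation puts its coefficient vector in the kernel of `N g'`.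
    refine Matrix.exists_mulVec_eq_zero_iff.1 ⟨a, fun h => hj (congrFun h j), ?_⟩
    ext i
    have := congrFun (congrArg φ ha) i
    simpa [Matrix.mulVec, dotProduct, N, mul_comm] using this
  have hdet : (N g).det = 0 :=
    hgZ _ ⟨isZariskiClosed_of_mem_regularFunctions hreg, hvanish⟩
  have hone : N g = 1 := by
    ext i j
    have := congrFun (LinearMap.congr_fun hφ (Pi.single j 1)) i
    simpa [Fintype.linearCombination_apply_single, N, Matrix.one_apply, Pi.single_apply] using this
  simp [hone] at hdet
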